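/- Let $\alpha\in(1/2,2/3)$ and $\delta>0$ be fixed. For each $n$, a map $x:[n]\to\{1,2\}$ is called a community assignment, and $A_x$ is the $n\times n$ matrix with $(A_x)_{ij}=1$ if $x(i)=x(j)$ and $(A_x)_{ij}=0$ otherwise. Let $y=y_n:[n]\to\{1,2\}$ be the true assignment, whose communities have sizes $|y^{-1}(1)|=\lfloor\alpha n\rfloor$ and $|y^{-1}(2)|=n-\lfloor\alpha n\rfloor$. Let $s=s_n>0$, let $(\xi_v)_{v\in[n]}$ be i.i.d. $N(0,s^2)$ random variables, let $W$ be the $n\times n$ matrix with $W_{ij}=\xi_i+\xi_j$, let $\Sigma$ be the $n^2\times n^2$ covariance matrix of the entries of $W$, $\Sigma_{ij;kl}=\mathrm{Cov}(W_{ij},W_{kl})$, and let $\Sigma^\dagger$ be its Moore–Penrose inverse. Given the observation $K=A_y+W$, let the maximum likelihood estimator be $$\hat y\in\operatorname*{argmin}_{x:[n]\to\{1,2\}}\ \sum_{i,j,k,l\in[n]}(K-A_x)_{ij}\,(\Sigma^\dagger)_{ij;kl}\,(K-A_x)_{kl},$$ the minimum being taken over all assignments (the community sizes are not known). Put $\theta(x,i,a)=1$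 if $x(i)=a$ and $\theta(x,i,a)=0$ otherwise, so that $(A_x)_{ij}=\theta(x,i,x(j))$, and let $C(y)$ be the set of all assignments $x$ such that, for all $i,j\in[n]$, $x(i)=x(j)$ if and only if $y(i)=y(j)$, and $\theta(x,i,x(j))=\theta(y,i,y(j))$; that is, the assignments that agree with $y$ up to a relabelling of the two communities. If $$ s<\frac{(1-\delta)(2\alpha-1)}{\sqrt{8\log n}}$$ for all sufficiently large $n$, then $\lim_{n\to\infty}\Pr(\hat y\in C(y))=1$. More precisely, the probability that every minimizer lies in $C(y)$ tends to $1$. -/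

import Mathlib

open MeasureTheory ProbabilityTheory Filter Topology

namespace GaussianMixture

/-! ### Moore-Penrose inverse of a real matrix -/

/-- `B` satisfies the four Penrose equations for the real matrix `A`. -/
structure IsMoorePenrose {m n : Type*} [Fintype m] [Fintype n]
    (A : Matrix m n ℝ) (B : Matrix n m ℝ) : Prop where
  mul_mul_self : A * B * A = A
  mul_mul_inv : B * A * B = B
  symm_left : (A * B).transpose = A * B
  symm_right : (B * A).transpose = B * A

/-- Uniqueness of the Moore-Penrose inverse. -/
theorem IsMoorePenrose.unique {m n : Type*} [Fintype m] [Fintype n]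
    {A : Matrix m n ℝ} {B C : Matrix n m ℝ}
    (hB : IsMoorePenrose A B) (hC : IsMoorePenrose A C) : B = C := by
  have h1 : A * B = A * C := by
    calc A * B = (A * B).transpose := hB.symm_left.symm
      _ = ((A * C) * (A * B)).transpose := by
          rw [← Matrix.mul_assoc, hC.mul_mul_self]
      _ = (A * B) * (A * C) := by
          rw [Matrix.transpose_mul, hB.symm_left, hC.symm_left]
      _ = A * C := by rw [← Matrix.mul_assoc, hB.mul_mul_self]
  have h2 : B * A = C * A := by
    calc B * A = (B * A).transpose := hB.symm_right.symm
      _ = ((B * A) * (C * A)).transpose := by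
          rw [Matrix.mul_assoc, ← Matrix.mul_assoc A, hC.mul_mul_self]
      _ = (C * A) * (B * A) := by
          rw [Matrix.transpose_mul, hB.symm_right, hC.symm_right]
      _ = C * A := by rw [Matrix.mul_assoc, ← Matrix.mul_assoc A, hB.mul_mul_self]
  calc B = B * A * B := hB.mul_mul_inv.symm
    _ = C * A * B := by rw [h2]
    _ = C * (A * B) := Matrix.mul_assoc _ _ _
    _ = C * A * C := by rw [h1, ← Matrix.mul_assoc]
    _ = C := hC.mul_mul_inv

/-- Transposition commutes with taking Moore-Penrose inverses. -/
theorem IsMoorePenrose.transpose {m n : Type*} [Fintype m] [Fintype n]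
    {A : Matrix m n ℝ} {B : Matrix n m ℝ} (hB : IsMoorePenrose A B) :
    IsMoorePenrose A.transpose B.transpose := by
  refine ⟨?_, ?_, ?_, ?_⟩
  · rw [Matrix.mul_assoc, ← Matrix.transpose_mul, ← Matrix.transpose_mul, hB.mul_mul_self]
  · rw [Matrix.mul_assoc, ← Matrix.transpose_mul, ← Matrix.transpose_mul, hB.mul_mul_inv]
  · rw [← Matrix.transpose_mul, hB.symm_right, hB.symm_right]
  · rw [← Matrix.transpose_mul, hB.symm_left, hB.symm_left]

/-- A real symmetric matrix has a Moore-Penrose inverse. -/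
theorem exists_isMoorePenrose_of_isHermitian {n : Type*} [Fintype n]
    {S : Matrix n n ℝ} (hS : S.IsHermitian) : ∃ B, IsMoorePenrose S B := by
  classical
  obtain ⟨U, V, d, hVU, hUV, hV, hSd⟩ : ∃ (U V : Matrix n n ℝ) (d : n → ℝ), V * U = 1 ∧
      U * V = 1 ∧ V = U.transpose ∧ S = U * Matrix.diagonal d * V := by
    refine ⟨hS.eigenvectorUnitary, star (hS.eigenvectorUnitary : Matrix n n ℝ), hS.eigenvalues,
      Unitary.coe_star_mul_self _, Unitary.coe_mul_star_self _, ?_, ?_⟩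
    · rw [Matrix.star_eq_conjTranspose, Matrix.conjTranspose_eq_transpose_of_trivial]
    · have h := hS.spectral_theorem
      rw [Unitary.conjStarAlgAut_apply] at h
      exact h
  have key : ∀ a b : n → ℝ, (U * Matrix.diagonal a * V) * (U * Matrix.diagonal b * V)
      = U * Matrix.diagonal (fun i => a i * b i) * V := by
    intro a b
    calc (U * Matrix.diagonal a * V) * (U * Matrix.diagonal b * V)
        = U * Matrix.diagonal a * (V * U) * (Matrix.diagonal b * V) := by
          simp only [Matrix.mul_assoc]
      _ = U * (Matrix.diagonal a * Matrix.diagonal b) * V := by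
          rw [hVU, Matrix.mul_one]; simp only [Matrix.mul_assoc]
      _ = _ := by rw [Matrix.diagonal_mul_diagonal]
  have ht : ∀ a : n → ℝ, (U * Matrix.diagonal a * V).transpose = U * Matrix.diagonal a * V := by
    intro a
    rw [hV, Matrix.transpose_mul, Matrix.transpose_mul, Matrix.transpose_transpose,
      Matrix.diagonal_transpose, Matrix.mul_assoc]
  refine ⟨U * Matrix.diagonal (fun i => (d i)⁻¹) * V, ?_, ?_, ?_, ?_⟩
  · rw [hSd, key, key]
    congr 3
    funext i
    exact mul_inv_mul_cancel (d i)
  · rw [hSd, key, key]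
    congr 3
    funext i
    by_cases h : d i = 0
    · simp [h]
    · field_simp
  · rw [hSd, key, ht]
  · rw [hSd, key, ht]

/-- Every real matrix has a Moore-Penrose inverse. -/
theorem exists_isMoorePenrose {m n : Type*} [Fintype m] [Fintype n]
    (A : Matrix m n ℝ) : ∃ B, IsMoorePenrose A B := by
  classical
  have hS : (A.transpose * A).transpose = A.transpose * A := by
    rw [Matrix.transpose_mul, Matrix.transpose_transpose]
  have hH : (A.transpose * A).IsHermitian := by
    rw [Matrix.IsHermitian, Matrix.conjTranspose_eq_transpose_of_trivial, hS]
  obtain ⟨B, hB⟩ := exists_isMoorePenrose_of_isHermitian hH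
  have hBt : B.transpose = B := by
    have h := hB.transpose
    rw [hS] at h
    exact h.unique hB
  have hA : A * (B * (A.transpose * A)) = A := by
    have h0 : A.transpose * (A * (B * (A.transpose * A)) - A) = 0 := by
      rw [Matrix.mul_sub, ← Matrix.mul_assoc, ← Matrix.mul_assoc, hB.mul_mul_self, sub_self]
    have h1 : (A * (B * (A.transpose * A)) - A).transpose * (A * (B * (A.transpose * A)) - A)
        = 0 := by
      have h2 : A * (B * (A.transpose * A)) - A = A * (B * (A.transpose * A) - 1) := by
        rw [Matrix.mul_sub, Matrix.mul_one]
      nth_rewrite 1 [h2]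
      rw [Matrix.transpose_mul, Matrix.mul_assoc, h0, Matrix.mul_zero]
    rw [← Matrix.conjTranspose_eq_transpose_of_trivial,
      Matrix.conjTranspose_mul_self_eq_zero] at h1
    exact sub_eq_zero.mp h1
  refine ⟨B * A.transpose, ?_, ?_, ?_, ?_⟩
  · rw [Matrix.mul_assoc, Matrix.mul_assoc, hA]
  · rw [Matrix.mul_assoc B, ← Matrix.mul_assoc, hB.mul_mul_inv]
  · rw [Matrix.transpose_mul, Matrix.transpose_mul, Matrix.transpose_transpose, hBt,
      Matrix.mul_assoc]
  · rw [Matrix.mul_assoc B, hB.symm_right]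

/-- The Moore-Penrose inverse of a real matrix. -/
noncomputable def moorePenrose {m n : Type*} [Fintype m] [Fintype n]
    (A : Matrix m n ℝ) : Matrix n m ℝ :=
  Classical.choose (exists_isMoorePenrose A)

theorem isMoorePenrose_moorePenrose {m n : Type*} [Fintype m] [Fintype n]
    (A : Matrix m n ℝ) : IsMoorePenrose A (moorePenrose A) :=
  Classical.choose_spec (exists_isMoorePenrose A)

/-! ### The Gaussian mixture model and its maximum likelihood estimator -/

/-- A community assignment mapping of `n` vertices to `k` communities. -/
abbrev Assignment (n k : ℕ) : Type := Fin n → Fin k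

/-- The signal matrix `A_x`, with entries `(A_x)_{ij} = θ(x, i, x(j))`. -/
def signal {p n k : ℕ} (θ : Assignment n k → Fin p → Fin k → ℝ) (x : Assignment n k) :
    Matrix (Fin p) (Fin n) ℝ :=
  Matrix.of fun i j => θ x i (x j)

/-- The class `C(x)` of the assignments that are obtained from `x` by a `θ`-preserving
bijection of the communities. -/
def equivClass {p n k : ℕ} (θ : Assignment n k → Fin p → Fin k → ℝ) (x : Assignment n k) :
    Set (Assignment n k) :=
  {x' | (∀ i j : Fin n, x i = x j ↔ x' i = x' j) ∧
    ∀ (i : Fin p) (j : Fin n), θ x i (x j) = θ x' i (x' j)}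

/-- The covariance matrix of (the entries of) a random `p × n` matrix `W`. -/
noncomputable def covMatrix {p n : ℕ} {Ω : Type*} [MeasurableSpace Ω] (μ : Measure Ω)
    (W : Ω → Matrix (Fin p) (Fin n) ℝ) : Matrix (Fin p × Fin n) (Fin p × Fin n) ℝ :=
  Matrix.of fun a b => cov[fun ω => W ω a.1 a.2, fun ω => W ω b.1 b.2; μ]

/-- The quadratic form
`∑ (K - A_x)_{ij} (S†)_{ij;kl} (K - A_x)_{kl}` that the MLE minimizes over `x`. -/
noncomputable def mleObjective {p n k : ℕ} (θ : Assignment n k → Fin p → Fin k → ℝ)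
    (S : Matrix (Fin p × Fin n) (Fin p × Fin n) ℝ) (K : Matrix (Fin p) (Fin n) ℝ)
    (x : Assignment n k) : ℝ :=
  ∑ a : Fin p × Fin n, ∑ b : Fin p × Fin n,
    (K - signal θ x) a.1 a.2 * moorePenrose S a b * (K - signal θ x) b.1 b.2

/-- The set `argmin` of all minimizers of `mleObjective` over all assignments, that is, of all
possible values of the MLE given the observation `K`. -/
def mleSet {p n k : ℕ} (θ : Assignment n k → Fin p → Fin k → ℝ)
    (S : Matrix (Fin p × Fin n) (Fin p × Fin n) ℝ) (K : Matrix (Fin p) (Fin n) ℝ) :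
    Set (Assignment n k) :=
  {x | ∀ z : Assignment n k, mleObjective θ S K x ≤ mleObjective θ S K z}

/-! ### The example: membership matrix plus noise attached to the vertices -/

/-- The function `θ` (with `p = n`) for which `(A_x)_{ij}` is `1` if `x(i) = x(j)`
and `0` otherwise. -/
def sameCommunity (n k : ℕ) : Assignment n k → Fin n → Fin k → ℝ :=
  fun x i a => if x i = a then 1 else 0

/-- The noise matrix `W_{ij} = ξ_i + ξ_j`. -/
def vertexNoise {n : ℕ} {Ω : Type*} (ξ : Fin n → Ω → ℝ) (ω : Ω) :
    Matrix (Fin n) (Fin n) ℝ :=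
  Matrix.of fun i j => ξ i ω + ξ j ω

/-- The observation `K_y = A_y + W`. -/
def observation {n k : ℕ} {Ω : Type*} (y : Assignment n k) (ξ : Fin n → Ω → ℝ) (ω : Ω) :
    Matrix (Fin n) (Fin n) ℝ :=
  signal (sameCommunity n k) y + vertexNoise ξ ω

end GaussianMixture

/-!
The noise is `W = L ξ`, where `L` maps `ξ` to the matrix `(ξ_i + ξ_j)`, so its covariance is
`s² L Lᵀ`. With the left inverse `R` of `L` for which `L R` is symmetric, the Moore-Penrose inverse
of the covariance is `s⁻² Rᵀ R`, and the objective at `x` is `s⁻² ‖d_x + ξ‖²` with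
`d_x = R (A_y - A_x)` (`mleObjective_observation`). Hence `x` can only be a minimizer if
`‖d_x + ξ‖ ≤ ‖ξ‖`, which by the Gaussian tail bound has probability at most
`exp (-‖d_x‖² / (8 s²))` (`measureReal_sum_sq_add_le`).

Write `u` and `w` for the excess over `1/2` of the fraction of vertices in community `0` under `y`
and `x`. The row sums of `A_x` are community sizes, whence `(R A_x)_i = 1/4 ± w - w²`, the sign
depending on the community of `i` (`pulledSignal_apply`). Exchanging the two labels of `x` changes
neither the objective nor membership in `C(y)` and negates `w`, so `w ≥ 0` may be assumed. Then
each vertex on which `x` and `y` differ contributes at least `((u + w) (1 - |w - u|))²` to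
`‖d_x‖²` (`sum_sq_pulledSignal_sub_ge`). When `t`, the number of these vertices, is at most a small
multiple of `n`, this is close to `(2u)² ≈ (2α - 1)²`, so the hypothesis on `s` bounds the
probability by `n ^ (-ρ t)` for some `ρ > 1`; for larger `t` it is at least a positive constant,
and the probability is at most `exp (-c n log n)`.

The Hamming distance has generating function `∑ₓ q ^ t(x) = (1 + q) ^ n`, so the union bound over
all assignments gives `((1 + n ^ (-ρ)) ^ n - 1) + 2 ^ n exp (-c n log n)`, which tends to `0`.
-/

namespace GaussianMixture

/-! ### The pseudoinverse of the covariance matrix -/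

/-- The matrix of the map `ξ ↦ (ξ_i + ξ_j)_{ij}`. -/
def incidence (n : ℕ) : Matrix (Fin n × Fin n) (Fin n) ℝ :=
  Matrix.of fun a v => (if a.1 = v then 1 else 0) + (if a.2 = v then 1 else 0)

/-- The Moore-Penrose inverse of `incidence n`, in closed form. -/
noncomputable def incidenceInv (n : ℕ) : Matrix (Fin n) (Fin n × Fin n) ℝ :=
  Matrix.of fun v a =>
    ((if a.1 = v then 1 else 0) + (if a.2 = v then 1 else 0)) / (2 * n) - 1 / (2 * n ^ 2)

theorem incidence_apply {n : ℕ} (i j v : Fin n) :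
    incidence n (i, j) v = (if i = v then 1 else 0) + (if j = v then 1 else 0) := rfl

theorem incidenceInv_mulVec (n : ℕ) (f : Fin n × Fin n → ℝ) (i : Fin n) :
    (incidenceInv n).mulVec f i
      = (∑ j, f (i, j) + ∑ j, f (j, i)) / (2 * n) - (∑ a, f a) / (2 * n ^ 2) := by
  have h : ∀ a : Fin n × Fin n, incidenceInv n i a * f a
      = (if a.1 = i then f a else 0) / (2 * n) + (if a.2 = i then f a else 0) / (2 * n)
        - f a / (2 * n ^ 2) := by
    intro a
    simp only [incidenceInv, Matrix.of_apply]
    split_ifs <;> ring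
  simp only [Matrix.mulVec, dotProduct, h, Finset.sum_sub_distrib, Finset.sum_add_distrib,
    ← Finset.sum_div]
  congr 1
  rw [add_div]
  congr 2
  · simp [Fintype.sum_prod_type, Finset.sum_ite_eq', Finset.sum_comm (γ := Fin n)]
  · simp [Fintype.sum_prod_type]

theorem incidenceInv_mul_incidence {n : ℕ} (hn : n ≠ 0) :
    incidenceInv n * incidence n = 1 := by
  ext i j
  have hn' : (n : ℝ) ≠ 0 := Nat.cast_ne_zero.mpr hn
  change (incidenceInv n).mulVec (fun a => incidence n a j) i = _
  rw [incidenceInv_mulVec]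
  simp only [Fintype.sum_prod_type, incidence_apply, Finset.sum_add_distrib, Matrix.one_apply,
    Finset.sum_const, Finset.card_univ, Fintype.card_fin, Finset.sum_ite_eq',
    Finset.mem_univ, if_true, nsmul_eq_mul, ← Finset.mul_sum]
  split_ifs <;> field_simp <;> ring

theorem incidence_mul_incidenceInv_transpose (n : ℕ) :
    (incidence n * incidenceInv n).transpose = incidence n * incidenceInv n := by
  have h : ∀ a b, (incidence n * incidenceInv n) a b
      = incidenceInv n a.1 b + incidenceInv n a.2 b := by
    intro a b
    simp [Matrix.mul_apply, incidence, add_mul, Finset.sum_add_distrib]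
  ext a b
  rw [Matrix.transpose_apply, h, h]
  simp only [incidenceInv, Matrix.of_apply, eq_comm (a := a.1), eq_comm (a := a.2)]
  ring

/-- The Moore-Penrose inverse of `c L Lᵀ` is `c⁻¹ Rᵀ R`, because `R L = 1` and `L R` is symmetric
for `L = incidence n` and `R = incidenceInv n`. -/
theorem isMoorePenrose_smul_mul_transpose {n : ℕ} (hn : n ≠ 0) {c : ℝ} (hc : c ≠ 0) :
    IsMoorePenrose (c • (incidence n * (incidence n).transpose))
      (c⁻¹ • ((incidenceInv n).transpose * incidenceInv n)) := by
  set L := incidence n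
  set R := incidenceInv n
  have hRL : R * L = 1 := incidenceInv_mul_incidence hn
  have hLR : (L * R).transpose = L * R := incidence_mul_incidenceInv_transpose n
  have hRLt : L.transpose * R.transpose = 1 := by
    rw [← Matrix.transpose_mul, hRL, Matrix.transpose_one]
  have hRtLt : R.transpose * L.transpose = L * R := by
    rw [← Matrix.transpose_mul, hLR]
  have h1 : (c • (L * L.transpose)) * (c⁻¹ • (R.transpose * R)) = L * R := by
    rw [Matrix.smul_mul, Matrix.mul_smul, smul_smul, mul_inv_cancel₀ hc, one_smul,
      Matrix.mul_assoc, ← Matrix.mul_assoc L.transpose, hRLt, Matrix.one_mul]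
  have h2 : (c⁻¹ • (R.transpose * R)) * (c • (L * L.transpose)) = L * R := by
    rw [Matrix.smul_mul, Matrix.mul_smul, smul_smul, inv_mul_cancel₀ hc, one_smul,
      Matrix.mul_assoc, ← Matrix.mul_assoc R, hRL, Matrix.one_mul, hRtLt]
  refine ⟨?_, ?_, ?_, ?_⟩
  · rw [h1, Matrix.mul_smul, Matrix.mul_assoc, ← Matrix.mul_assoc R, hRL, Matrix.one_mul]
  · rw [h2, Matrix.mul_smul, ← hRtLt, Matrix.mul_assoc, ← Matrix.mul_assoc L.transpose, hRLt,
      Matrix.one_mul]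
  · rw [h1, hLR]
  · rw [h2, hLR]

/-- For noise `incidence n *ᵥ ξ` with i.i.d. coordinates of variance `c`, the quadratic form
that the estimator minimizes is `c⁻¹` times the squared norm of the residual, pulled back to
the space of `ξ`. -/
theorem mleObjective_eq {n k : ℕ} (hn : n ≠ 0) {c : ℝ} (hc : c ≠ 0)
    (θ : Assignment n k → Fin n → Fin k → ℝ) (K : Matrix (Fin n) (Fin n) ℝ)
    (x : Assignment n k) :
    mleObjective θ (c • (incidence n * (incidence n).transpose)) K x
      = c⁻¹ * ∑ i, ((incidenceInv n).mulVec (fun a => (K - signal θ x) a.1 a.2) i) ^ 2 := by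
  have hP := (isMoorePenrose_moorePenrose (c • (incidence n * (incidence n).transpose))).unique
    (isMoorePenrose_smul_mul_transpose hn hc)
  set f : Fin n × Fin n → ℝ := fun a => (K - signal θ x) a.1 a.2
  have h1 : mleObjective θ (c • (incidence n * (incidence n).transpose)) K x
      = dotProduct f ((c⁻¹ • ((incidenceInv n).transpose * incidenceInv n)).mulVec f) := by
    unfold mleObjective
    rw [hP]
    simp only [dotProduct, Matrix.mulVec, Finset.mul_sum, f, mul_assoc]
  rw [h1, Matrix.smul_mulVec, dotProduct_smul, ← Matrix.mulVec_mulVec, Matrix.dotProduct_mulVec,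
    Matrix.vecMul_transpose, smul_eq_mul]
  simp only [dotProduct, sq]

theorem covMatrix_vertexNoise {n : ℕ} {Ω : Type*} [MeasurableSpace Ω] {μ : Measure Ω}
    [IsProbabilityMeasure μ] {ξ : Fin n → Ω → ℝ} {c : ℝ} (hL2 : ∀ v, MemLp (ξ v) 2 μ)
    (hvar : ∀ v, Var[ξ v; μ] = c) (hindep : iIndepFun ξ μ) :
    covMatrix μ (vertexNoise ξ) = c • (incidence n * (incidence n).transpose) := by
  have hcov : ∀ i j, cov[ξ i, ξ j; μ] = if i = j then c else 0 := by
    intro i j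
    split_ifs with h
    · rw [h, covariance_self (hL2 j).aemeasurable, hvar]
    · exact (hindep.indepFun h).covariance_eq_zero (hL2 i) (hL2 j)
  ext a b
  have h1 : covMatrix μ (vertexNoise ξ) a b
      = cov[ξ a.1 + ξ a.2, ξ b.1 + ξ b.2; μ] := rfl
  rw [h1, covariance_add_left (hL2 _) (hL2 _) ((hL2 _).add (hL2 _)),
    covariance_add_right (hL2 _) (hL2 _) (hL2 _), covariance_add_right (hL2 _) (hL2 _) (hL2 _)]
  simp only [hcov, Matrix.smul_apply, Matrix.mul_apply, incidence, Matrix.transpose_apply,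
    Matrix.of_apply, add_mul, ite_mul, one_mul, zero_mul, Finset.sum_add_distrib,
    Finset.sum_ite_eq, Finset.mem_univ, if_true, smul_eq_mul]
  simp only [eq_comm (a := b.1), eq_comm (a := b.2)]
  split_ifs <;> ring

/-! ### The signal seen through the pseudoinverse -/

/-- The excess over `1/2` of the fraction of the vertices that `x` puts into community `0`. -/
noncomputable def imbalance {n : ℕ} (x : Assignment n 2) : ℝ :=
  ((Finset.univ.filter fun v => x v = 0).card : ℝ) / n - 1 / 2

/-- The signal `A_x` pulled back to the space of the vertex noise. -/
noncomputable def pulledSignal {n : ℕ} (x : Assignment n 2) : Fin n → ℝ :=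
  (incidenceInv n).mulVec fun a => signal (sameCommunity n 2) x a.1 a.2

theorem signal_sameCommunity_apply {n : ℕ} (x : Assignment n 2) (i j : Fin n) :
    signal (sameCommunity n 2) x i j = if x i = x j then 1 else 0 := rfl

/-- The row sums of `A_x` are the community sizes, so the pulled back signal depends on `i` only
through the community of `i`. -/
theorem pulledSignal_apply {n : ℕ} (hn : n ≠ 0) (x : Assignment n 2) (i : Fin n) :
    pulledSignal x i
      = 1 / 4 + (if x i = 0 then imbalance x else -imbalance x) - imbalance x ^ 2 := by
  have hn' : (n : ℝ) ≠ 0 := Nat.cast_ne_zero.mpr hn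
  set M : ℝ := ((Finset.univ.filter fun v => x v = 0).card : ℝ)
  have h0 : ∑ v, (if x v = 0 then (1 : ℝ) else 0) = M := by
    rw [Finset.sum_boole]
  -- With two communities, the indicator of `x i = x j` is a polynomial in the indicators of
  -- community `0`, which makes all the sums below factor.
  have hsame : ∀ i j, (if x i = x j then (1 : ℝ) else 0)
      = (if x i = 0 then (1 : ℝ) else 0) * (if x j = 0 then 1 else 0)
        + (1 - (if x i = 0 then (1 : ℝ) else 0)) * (1 - (if x j = 0 then 1 else 0)) := by
    intro i j
    rcases Fin.exists_fin_two.mp ⟨x i, rfl⟩ with h | h <;>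
    rcases Fin.exists_fin_two.mp ⟨x j, rfl⟩ with h' | h' <;> simp [h, h']
  have hrow : ∀ i, ∑ j, (if x i = x j then (1 : ℝ) else 0)
      = (if x i = 0 then (1 : ℝ) else 0) * M
        + (1 - (if x i = 0 then (1 : ℝ) else 0)) * (n - M) := by
    intro i
    simp only [hsame, Finset.sum_add_distrib, ← Finset.mul_sum, Finset.sum_sub_distrib, h0]
    simp
  have hcol : ∀ i, ∑ j, (if x j = x i then (1 : ℝ) else 0)
      = ∑ j, (if x i = x j then (1 : ℝ) else 0) := by
    intro i
    simp only [eq_comm]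
  have htot : ∑ a : Fin n × Fin n, (if x a.1 = x a.2 then (1 : ℝ) else 0)
      = M * M + (n - M) * (n - M) := by
    rw [Fintype.sum_prod_type]
    simp only [hrow, Finset.sum_add_distrib, ← Finset.sum_mul, Finset.sum_sub_distrib, h0]
    simp
  have hw : imbalance x = M / n - 1 / 2 := rfl
  rw [pulledSignal, incidenceInv_mulVec]
  simp only [signal_sameCommunity_apply]
  rw [hcol, htot, hrow, hw]
  split_ifs <;> field_simp <;> ring

theorem imbalance_le_half {n : ℕ} (x : Assignment n 2) : imbalance x ≤ 1 / 2 := by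
  have h : ((Finset.univ.filter fun v => x v = 0).card : ℝ) ≤ n := by
    exact_mod_cast (Finset.card_le_univ _).trans_eq (Fintype.card_fin n)
  have := div_le_one_of_le₀ h (Nat.cast_nonneg n)
  rw [imbalance]
  linarith

theorem abs_imbalance_sub_le {n : ℕ} (x y : Assignment n 2) :
    |imbalance x - imbalance y| ≤ (hammingDist x y : ℝ) / n := by
  have key : ∀ x y : Assignment n 2, (Finset.univ.filter fun v => x v = 0).card
      ≤ hammingDist x y + (Finset.univ.filter fun v => y v = 0).card := by
    intro x y
    refine (Finset.card_le_card ?_).trans (Finset.card_union_le _ _)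
    intro v hv
    simp only [Finset.mem_filter, Finset.mem_univ, true_and, Finset.mem_union] at hv ⊢
    by_cases h : x v = y v
    · exact Or.inr (h ▸ hv)
    · exact Or.inl h
  have h1 : ((Finset.univ.filter fun v => x v = 0).card : ℝ)
      ≤ hammingDist x y + (Finset.univ.filter fun v => y v = 0).card := by
    exact_mod_cast key x y
  have h2 : ((Finset.univ.filter fun v => y v = 0).card : ℝ)
      ≤ hammingDist x y + (Finset.univ.filter fun v => x v = 0).card := by
    have := key y x
    rw [hammingDist_comm] at this
    exact_mod_cast this
  rw [imbalance, imbalance, sub_sub_sub_cancel_right, ← sub_div, abs_div, Nat.abs_cast]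
  gcongr
  rw [abs_le]
  constructor <;> linarith

/-- Each vertex on which `x` and `y` disagree contributes at least
`((u + w) (1 - |w - u|))²` to the squared distance of the pulled back signals, where `u` and `w`
are the imbalances of `y` and `x`. -/
theorem sum_sq_pulledSignal_sub_ge {n : ℕ} (hn : n ≠ 0) {x y : Assignment n 2}
    (hx : 0 ≤ imbalance x) (hy : 0 ≤ imbalance y) :
    hammingDist x y * ((imbalance y + imbalance x) * (1 - |imbalance x - imbalance y|)) ^ 2
      ≤ ∑ i, (pulledSignal y i - pulledSignal x i) ^ 2 := by
  set u := imbalance y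
  set w := imbalance x
  have hu2 : u ≤ 1 / 2 := imbalance_le_half y
  have hw2 : w ≤ 1 / 2 := imbalance_le_half x
  have habs : |w - u| ≤ 1 := abs_le.mpr ⟨by linarith, by linarith⟩
  have hterm : ∀ i ∈ Finset.univ.filter fun i => x i ≠ y i,
      ((u + w) * (1 - |w - u|)) ^ 2 ≤ (pulledSignal y i - pulledSignal x i) ^ 2 := by
    intro i hi
    have hne : x i ≠ y i := (Finset.mem_filter.mp hi).2
    rw [pulledSignal_apply hn, pulledSignal_apply hn, sq_le_sq,
      abs_of_nonneg (mul_nonneg (add_nonneg hy hx) (sub_nonneg.mpr habs))]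
    by_cases h : y i = 0
    · have h' : x i ≠ 0 := fun h0 => hne (h0.trans h.symm)
      rw [if_pos h, if_neg h']
      refine le_trans ?_ (le_abs_self _)
      have : (u + w) * (1 - |w - u|) ≤ (u + w) * (1 + (w - u)) :=
        mul_le_mul_of_nonneg_left (by linarith [neg_abs_le (w - u)]) (add_nonneg hy hx)
      linarith
    · have h' : x i = 0 := by
        have := hne
        omega
      rw [if_neg h, if_pos h']
      refine le_trans ?_ (neg_le_abs _)
      have : (u + w) * (1 - |w - u|) ≤ (u + w) * (1 - (w - u)) :=
        mul_le_mul_of_nonneg_left (by linarith [le_abs_self (w - u)]) (add_nonneg hy hx)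
      linarith
  calc hammingDist x y * ((u + w) * (1 - |w - u|)) ^ 2
      = ∑ i ∈ Finset.univ.filter fun i => x i ≠ y i, ((u + w) * (1 - |w - u|)) ^ 2 := by
        rw [Finset.sum_const, nsmul_eq_mul]; rfl
    _ ≤ ∑ i ∈ Finset.univ.filter fun i => x i ≠ y i, (pulledSignal y i - pulledSignal x i) ^ 2 :=
        Finset.sum_le_sum hterm
    _ ≤ _ := Finset.sum_le_sum_of_subset_of_nonneg (Finset.filter_subset _ _)
        fun i _ _ => sq_nonneg _

/-! ### Exchanging the two communities -/

theorem signal_comp_perm {n : ℕ} (e : Equiv.Perm (Fin 2)) (x : Assignment n 2) :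
    signal (sameCommunity n 2) (e ∘ x) = signal (sameCommunity n 2) x := by
  ext i j
  simp [signal_sameCommunity_apply]

/-- For the same-community signal, the second condition in `equivClass` implies the first. -/
theorem mem_equivClass_iff {n : ℕ} (x y : Assignment n 2) :
    x ∈ equivClass (sameCommunity n 2) y
      ↔ signal (sameCommunity n 2) x = signal (sameCommunity n 2) y := by
  constructor
  · intro h
    ext i j
    exact (h.2 i j).symm
  · intro h
    refine ⟨fun i j => ?_, fun i j => (congrFun (congrFun h i) j).symm⟩
    have := congrFun (congrFun h i) j
    rw [signal_sameCommunity_apply, signal_sameCommunity_apply] at this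
    by_cases h1 : x i = x j <;> by_cases h2 : y i = y j <;> simp_all

theorem imbalance_swap {n : ℕ} (hn : n ≠ 0) (x : Assignment n 2) :
    imbalance (Equiv.swap 0 1 ∘ x) = -imbalance x := by
  have hn' : (n : ℝ) ≠ 0 := Nat.cast_ne_zero.mpr hn
  have hset : (Finset.univ.filter fun v => (Equiv.swap (0 : Fin 2) 1 ∘ x) v = 0)
      = Finset.univ.filter fun v => ¬ x v = 0 := by
    ext v
    rcases Fin.exists_fin_two.mp ⟨x v, rfl⟩ with h | h <;> simp [h]
  have hcard := Finset.card_filter_add_card_filter_not (s := (Finset.univ : Finset (Fin n)))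
    (fun v => x v = 0)
  rw [Finset.card_univ, Fintype.card_fin] at hcard
  have hcard' : ((Finset.univ.filter fun v => x v = 0).card : ℝ)
      + (Finset.univ.filter fun v => ¬ x v = 0).card = n := by exact_mod_cast hcard
  rw [imbalance, imbalance, hset, eq_sub_iff_add_eq'.mpr hcard']
  field_simp
  ring

theorem exists_signal_eq_imbalance_nonneg {n : ℕ} (hn : n ≠ 0) (x : Assignment n 2) :
    ∃ z : Assignment n 2, signal (sameCommunity n 2) z = signal (sameCommunity n 2) x ∧
      0 ≤ imbalance z := by
  rcases le_total 0 (imbalance x) with h | h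
  · exact ⟨x, rfl, h⟩
  · exact ⟨_, signal_comp_perm (Equiv.swap 0 1) x, by rw [imbalance_swap hn]; linarith⟩

theorem mleObjective_congr {n : ℕ} {S : Matrix (Fin n × Fin n) (Fin n × Fin n) ℝ}
    {K : Matrix (Fin n) (Fin n) ℝ} {x z : Assignment n 2}
    (h : signal (sameCommunity n 2) z = signal (sameCommunity n 2) x) :
    mleObjective (sameCommunity n 2) S K z = mleObjective (sameCommunity n 2) S K x := by
  rw [mleObjective, mleObjective, h]

/-! ### The probability that a fixed assignment beats the true one -/

theorem hasSubgaussianMGF_of_hasLaw_gaussianReal {Ω : Type*} [MeasurableSpace Ω]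
    {μ : Measure Ω} {X : Ω → ℝ} {c : NNReal} (h : HasLaw X (gaussianReal 0 c) μ) :
    HasSubgaussianMGF X c μ where
  integrable_exp_mul t := by
    have h1 : Integrable (fun x => Real.exp (t * x)) (μ.map X) := by
      rw [h.map_eq]
      exact integrable_exp_mul_gaussianReal t
    exact h1.comp_aemeasurable h.aemeasurable
  mgf_le t := by
    rw [mgf_gaussianReal h.map_eq]
    simp

/-- The event that the shift by `d` does not increase the norm of a centred isotropic Gaussian
vector is a half space at distance `‖d‖ / 2` from the origin. -/
theorem measureReal_sum_sq_add_le {Ω : Type*} [MeasurableSpace Ω] {μ : Measure Ω}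
    [IsProbabilityMeasure μ] {ι : Type*} [Fintype ι] {ξ : ι → Ω → ℝ} {s : ℝ} (hs : 0 < s)
    (hlaw : ∀ v, HasLaw (ξ v) (gaussianReal 0 (s ^ 2).toNNReal) μ) (hindep : iIndepFun ξ μ)
    (d : ι → ℝ) :
    μ.real {ω | ∑ i, (d i + ξ i ω) ^ 2 ≤ ∑ i, ξ i ω ^ 2}
      ≤ Real.exp (-(∑ i, d i ^ 2) / (8 * s ^ 2)) := by
  set D := ∑ i, d i ^ 2 with hD
  have hD0 : 0 ≤ D := Finset.sum_nonneg fun i _ => sq_nonneg _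
  rcases hD0.eq_or_lt with h0 | hpos
  · rw [← h0, neg_zero, zero_div, Real.exp_zero]
    exact measureReal_le_one
  have hset : {ω | ∑ i, (d i + ξ i ω) ^ 2 ≤ ∑ i, ξ i ω ^ 2}
      = {ω | D / 2 ≤ ∑ i, (-d i) * ξ i ω} := by
    ext ω
    have : ∑ i, (d i + ξ i ω) ^ 2 = D - 2 * ∑ i, (-d i) * ξ i ω + ∑ i, ξ i ω ^ 2 := by
      rw [hD, Finset.mul_sum, ← Finset.sum_sub_distrib, ← Finset.sum_add_distrib]
      exact Finset.sum_congr rfl fun i _ => by ring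
    rw [Set.mem_ofPred_eq, Set.mem_ofPred_eq, this]
    constructor <;> intro h <;> linarith
  have hind : iIndepFun (fun i ω => (-d i) * ξ i ω) μ :=
    hindep.comp (fun i x => (-d i) * x) fun i => measurable_const_mul _
  have hsub : ∀ i, HasSubgaussianMGF (fun ω => (-d i) * ξ i ω) (d i ^ 2 * s ^ 2).toNNReal μ := by
    intro i
    have h := (hasSubgaussianMGF_of_hasLaw_gaussianReal (hlaw i)).const_mul (-d i)
    have e : NNReal.mk ((-d i) ^ 2) (sq_nonneg _) * (s ^ 2).toNNReal
        = (d i ^ 2 * s ^ 2).toNNReal := by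
      rw [Real.toNNReal_mul (sq_nonneg _), ← neg_sq (d i),
        Real.toNNReal_of_nonneg (sq_nonneg (-d i))]
    exact e ▸ h
  have htail := HasSubgaussianMGF.measure_sum_ge_le_of_iIndepFun hind (s := Finset.univ)
    (fun i _ => hsub i) (half_pos hpos).le
  rw [hset]
  refine htail.trans_eq ?_
  have hc : ∑ i, ((d i ^ 2 * s ^ 2).toNNReal : ℝ) = D * s ^ 2 := by
    rw [hD, Finset.sum_mul]
    exact Finset.sum_congr rfl fun i _ => Real.coe_toNNReal _ (by positivity)
  rw [NNReal.coe_sum, hc]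
  congr 1
  field_simp
  ring

theorem mleObjective_observation {n : ℕ} (hn : n ≠ 0) {Ω : Type*} [MeasurableSpace Ω]
    {μ : Measure Ω} [IsProbabilityMeasure μ] {ξ : Fin n → Ω → ℝ} {s : ℝ} (hs : 0 < s)
    (hlaw : ∀ v, HasLaw (ξ v) (gaussianReal 0 (s ^ 2).toNNReal) μ) (hindep : iIndepFun ξ μ)
    (y x : Assignment n 2) (ω : Ω) :
    mleObjective (sameCommunity n 2) (covMatrix μ (vertexNoise ξ)) (observation y ξ ω) x
      = (s ^ 2)⁻¹ * ∑ i, (pulledSignal y i - pulledSignal x i + ξ i ω) ^ 2 := by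
  have hL2 : ∀ v, MemLp (ξ v) 2 μ := fun v => by
    simpa using (hasSubgaussianMGF_of_hasLaw_gaussianReal (hlaw v)).memLp 2
  have hvar : ∀ v, Var[ξ v; μ] = s ^ 2 := fun v => by
    rw [(hlaw v).variance_eq, variance_id_gaussianReal, Real.coe_toNNReal _ (sq_nonneg s)]
  rw [covMatrix_vertexNoise hL2 hvar hindep, mleObjective_eq hn (pow_pos hs 2).ne']
  congr 1
  refine Finset.sum_congr rfl fun i _ => ?_
  congr 1
  have hnoise : (fun a : Fin n × Fin n => vertexNoise ξ ω a.1 a.2)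
      = (incidence n).mulVec fun v => ξ v ω := by
    ext a
    simp [vertexNoise, Matrix.mulVec, dotProduct, incidence, add_mul, Finset.sum_add_distrib]
  have hsplit : (fun a : Fin n × Fin n =>
        (observation y ξ ω - signal (sameCommunity n 2) x) a.1 a.2)
      = (fun a => signal (sameCommunity n 2) y a.1 a.2)
        - (fun a => signal (sameCommunity n 2) x a.1 a.2)
        + (fun a => vertexNoise ξ ω a.1 a.2) := by
    ext a
    simp only [observation, Matrix.sub_apply, Matrix.add_apply, Pi.add_apply, Pi.sub_apply]
    ring
  rw [hsplit, hnoise, Matrix.mulVec_add, Matrix.mulVec_sub, Matrix.mulVec_mulVec,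
    incidenceInv_mul_incidence hn, Matrix.one_mulVec]
  rfl

/-- The union bound over the assignments whose larger community carries the label `0`. -/
theorem measureReal_not_mleSet_subset_le {n : ℕ} (hn : n ≠ 0) {Ω : Type*} [MeasurableSpace Ω]
    {μ : Measure Ω} [IsProbabilityMeasure μ] {ξ : Fin n → Ω → ℝ} {s : ℝ} (hs : 0 < s)
    (hlaw : ∀ v, HasLaw (ξ v) (gaussianReal 0 (s ^ 2).toNNReal) μ) (hindep : iIndepFun ξ μ)
    (y : Assignment n 2) :
    μ.real {ω | mleSet (sameCommunity n 2) (covMatrix μ (vertexNoise ξ)) (observation y ξ ω)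
        ⊆ equivClass (sameCommunity n 2) y}ᶜ
      ≤ ∑ z ∈ Finset.univ.filter fun z : Assignment n 2 => z ≠ y ∧ 0 ≤ imbalance z,
          Real.exp (-(∑ i, (pulledSignal y i - pulledSignal z i) ^ 2) / (8 * s ^ 2)) := by
  refine le_trans (measureReal_mono ?_ (measure_ne_top _ _))
    ((measureReal_biUnion_finset_le _ _).trans (Finset.sum_le_sum fun z _ =>
      measureReal_sum_sq_add_le hs hlaw hindep fun i => pulledSignal y i - pulledSignal z i))
  intro ω hω
  rw [Set.mem_compl_iff, Set.mem_ofPred_eq, Set.not_subset] at hω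
  obtain ⟨x, hx, hxy⟩ := hω
  obtain ⟨z, hz, hz0⟩ := exists_signal_eq_imbalance_nonneg hn x
  have hzy : z ≠ y := by
    rintro rfl
    exact hxy ((mem_equivClass_iff _ _).mpr hz.symm)
  have hle := hx y
  rw [← mleObjective_congr hz, mleObjective_observation hn hs hlaw hindep,
    mleObjective_observation hn hs hlaw hindep] at hle
  have hle' := le_of_mul_le_mul_left hle (inv_pos.mpr (pow_pos hs 2))
  simp only [sub_self, zero_add] at hle'
  exact Set.mem_biUnion (Finset.mem_coe.mpr (Finset.mem_filter.mpr ⟨Finset.mem_univ _, hzy, hz0⟩))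
    hle'

/-! ### Summing the error probabilities -/

/-- The generating function of the Hamming distance to a fixed word over a binary alphabet. -/
theorem sum_pow_hammingDist {ι : Type*} [Fintype ι] [DecidableEq ι] (y : ι → Fin 2) (q : ℝ) :
    ∑ z : ι → Fin 2, q ^ hammingDist z y = (1 + q) ^ Fintype.card ι := by
  have h1 : ∀ i, ∑ a : Fin 2, (if a ≠ y i then q else 1) = 1 + q := by
    intro i
    rcases Fin.exists_fin_two.mp ⟨y i, rfl⟩ with h | h <;> simp [h, Fin.sum_univ_two, add_comm]
  calc ∑ z : ι → Fin 2, q ^ hammingDist z y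
      = ∑ z : ι → Fin 2, ∏ i, (if z i ≠ y i then q else 1) := by
        refine Finset.sum_congr rfl fun z _ => ?_
        rw [Finset.prod_ite, Finset.prod_const, Finset.prod_const_one, mul_one]
        rfl
    _ = ∏ i, ∑ a : Fin 2, (if a ≠ y i then q else 1) := by
        rw [Finset.prod_univ_sum, Fintype.piFinset_univ]
    _ = (1 + q) ^ Fintype.card ι := by
        simp only [h1, Finset.prod_const, Finset.card_univ]

theorem sum_ne_pow_hammingDist_add_const {n : ℕ} (y : Assignment n 2) (q r : ℝ) (hr : 0 ≤ r) :
    ∑ z ∈ Finset.univ.filter fun z : Assignment n 2 => z ≠ y, (q ^ hammingDist z y + r)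
      ≤ ((1 + q) ^ n - 1) + 2 ^ n * r := by
  have h := sum_pow_hammingDist y q
  rw [Fintype.card_fin] at h
  rw [Finset.sum_add_distrib, Finset.filter_ne', Finset.sum_const, nsmul_eq_mul]
  have h2 := Finset.add_sum_erase Finset.univ (fun z => q ^ hammingDist z y) (Finset.mem_univ y)
  simp only [hammingDist_self, pow_zero] at h2
  have h3 : ((Finset.univ.erase y).card : ℝ) ≤ 2 ^ n := by
    have := (Finset.card_erase_le (s := Finset.univ) (a := y)).trans_eq Finset.card_univ
    rw [Fintype.card_fun, Fintype.card_fin, Fintype.card_fin] at this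
    exact_mod_cast this
  have h4 := mul_le_mul_of_nonneg_right h3 hr
  linarith

/-- The two terms cover two regimes. If at most `(a - κ) n / 6` vertices are misclassified, the
imbalances of `x` and `y` are so close that each error contributes at least
`((a + κ) / 2)² > κ²` to the squared distance. Otherwise each error still contributes at least
`(a / 8)²`, and the linearly many of them give an exponent of order `n log n`, which outweighs
the `2 ^ n` assignments. -/
theorem exp_neg_sum_sq_pulledSignal_sub_le {n : ℕ} (hn : n ≠ 0) {a κ σ : ℝ} (hκ : 0 < κ)
    (hκa : κ < a) (ha1 : a ≤ 1) (hσ : 0 < σ)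
    (hσκ : 8 * σ ^ 2 * Real.log n ≤ κ ^ 2) {x y : Assignment n 2} (hx : 0 ≤ imbalance x)
    (hy : a / 2 - (a - κ) / 12 ≤ imbalance y) :
    Real.exp (-(∑ i, (pulledSignal y i - pulledSignal x i) ^ 2) / (8 * σ ^ 2))
      ≤ Real.exp (-(((a + κ) / 2) ^ 2 / κ ^ 2 * Real.log n)) ^ hammingDist x y
        + Real.exp (-((a - κ) / 6 * (a / 8) ^ 2 / κ ^ 2 * n * Real.log n)) := by
  have hn0 : (0 : ℝ) < n := by positivity
  have hy0 : 0 ≤ imbalance y := by linarith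
  have hsum := sum_sq_pulledSignal_sub_ge hn hx hy0
  have hham := abs_imbalance_sub_le x y
  have hu2 := imbalance_le_half y
  have hw2 := imbalance_le_half x
  set t : ℝ := (hammingDist x y : ℝ) with ht
  have ht0 : 0 ≤ t := Nat.cast_nonneg _
  set D := ∑ i, (pulledSignal y i - pulledSignal x i) ^ 2
  set u := imbalance y
  set w := imbalance x
  set l := Real.log n
  have hl : 0 ≤ l := Real.log_natCast_nonneg n
  have hD0 : 0 ≤ D := Finset.sum_nonneg fun i _ => sq_nonneg _
  have hDσ : D * l / κ ^ 2 ≤ D / (8 * σ ^ 2) := by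
    rw [div_le_div_iff₀ (by positivity) (by positivity)]
    nlinarith
  rcases le_or_gt (t / n) ((a - κ) / 6) with hsmall | hlarge
  · have hm : (a + κ) / 2 ≤ (u + w) * (1 - |w - u|) := by
      have h1 : a - 2 * ((a - κ) / 6) ≤ u + w := by linarith [neg_abs_le (w - u)]
      have h2 : 1 - (a - κ) / 6 ≤ 1 - |w - u| := by linarith
      have h3 := mul_le_mul h1 h2 (by linarith) (by linarith)
      nlinarith
    have hD : t * ((a + κ) / 2) ^ 2 ≤ D :=
      le_trans (mul_le_mul_of_nonneg_left (pow_le_pow_left₀ (by linarith) hm 2) ht0) hsum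
    refine le_add_of_le_of_nonneg ?_ (Real.exp_pos _).le
    rw [← Real.exp_nat_mul, Real.exp_le_exp, neg_div, mul_neg, neg_le_neg_iff]
    refine le_trans ?_ hDσ
    calc (hammingDist x y : ℝ) * (((a + κ) / 2) ^ 2 / κ ^ 2 * l)
        = t * ((a + κ) / 2) ^ 2 * l / κ ^ 2 := by rw [ht]; ring
      _ ≤ D * l / κ ^ 2 :=
          div_le_div_of_nonneg_right (mul_le_mul_of_nonneg_right hD hl) (sq_nonneg κ)
  · -- Both imbalances lie in `[0, 1/2]`, so `1 - |w - u|` never drops below `1/2`.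
    have hm : a / 8 ≤ (u + w) * (1 - |w - u|) := by
      have h1 : a / 4 ≤ u + w := by linarith
      have h2 : 1 / 2 ≤ 1 - |w - u| := by
        have : |w - u| ≤ 1 / 2 := abs_le.mpr ⟨by linarith, by linarith⟩
        linarith
      have h3 := mul_le_mul h1 h2 (by norm_num) (by linarith)
      linarith
    have hD : (a - κ) / 6 * n * (a / 8) ^ 2 ≤ D := by
      have h1 : (a - κ) / 6 * n ≤ t := ((lt_div_iff₀ hn0).mp hlarge).le
      exact le_trans (mul_le_mul h1 (pow_le_pow_left₀ (by linarith) hm 2) (sq_nonneg _) ht0) hsum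
    refine le_add_of_nonneg_of_le (pow_nonneg (Real.exp_pos _).le _) ?_
    rw [Real.exp_le_exp, neg_div, neg_le_neg_iff]
    refine le_trans ?_ hDσ
    calc (a - κ) / 6 * (a / 8) ^ 2 / κ ^ 2 * n * l
        = (a - κ) / 6 * n * (a / 8) ^ 2 * l / κ ^ 2 := by ring
      _ ≤ D * l / κ ^ 2 :=
          div_le_div_of_nonneg_right (mul_le_mul_of_nonneg_right hD hl) (sq_nonneg κ)

/-- The main term tends to `0` because `(1 + q) ^ n ≤ exp (n q)` and `n q = n ^ (1 - ρ)` for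
`q = n ^ (-ρ)`. -/
theorem tendsto_union_bound {ρ c : ℝ} (hρ : 1 < ρ) (hc : 0 < c) :
    Tendsto (fun n : ℕ => ((1 + Real.exp (-(ρ * Real.log n))) ^ n - 1)
      + 2 ^ n * Real.exp (-(c * n * Real.log n))) atTop (𝓝 0) := by
  have hlog : Tendsto (fun n : ℕ => Real.log n) atTop atTop :=
    Real.tendsto_log_atTop.comp tendsto_natCast_atTop_atTop
  have h1 : Tendsto (fun n : ℕ => Real.exp (Real.exp ((1 - ρ) * Real.log n)) - 1) atTop (𝓝 0) := by
    have h : Tendsto (fun n : ℕ => Real.exp ((1 - ρ) * Real.log n)) atTop (𝓝 0) :=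
      Real.tendsto_exp_atBot.comp (hlog.const_mul_atTop_of_neg (by linarith))
    simpa using ((Real.continuous_exp.tendsto 0).comp h).sub_const 1
  have h2 : Tendsto (fun n : ℕ => Real.exp ((n : ℝ) * (Real.log 2 - c * Real.log n)))
      atTop (𝓝 0) := by
    refine Real.tendsto_exp_atBot.comp (tendsto_natCast_atTop_atTop.atTop_mul_atBot₀ ?_)
    have := tendsto_atBot_add_const_left atTop (Real.log 2)
      (hlog.const_mul_atTop_of_neg (neg_neg_of_pos hc))
    simpa [sub_eq_add_neg] using this
  have h12 := h1.add h2
  rw [add_zero] at h12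
  refine squeeze_zero' (Eventually.of_forall fun n => ?_) ?_ h12
  · have : (1 : ℝ) ≤ (1 + Real.exp (-(ρ * Real.log n))) ^ n :=
      one_le_pow₀ (by linarith [Real.exp_pos (-(ρ * Real.log n))])
    have h3 : 0 ≤ (2 : ℝ) ^ n * Real.exp (-(c * n * Real.log n)) := by positivity
    linarith
  · filter_upwards [eventually_gt_atTop 0] with n hn
    have hn0 : (0 : ℝ) < n := Nat.cast_pos.mpr hn
    refine add_le_add (sub_le_sub_right ?_ 1) (le_of_eq ?_)
    · have hq : (n : ℝ) * Real.exp (-(ρ * Real.log n)) = Real.exp ((1 - ρ) * Real.log n) := by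
        nth_rewrite 1 [← Real.exp_log hn0]
        rw [← Real.exp_add]
        congr 1
        ring
      rw [← hq, Real.exp_nat_mul]
      refine pow_le_pow_left₀ (by positivity) ?_ n
      rw [add_comm]
      exact Real.add_one_le_exp _
    · nth_rewrite 1 [← Real.exp_log (zero_lt_two : (0 : ℝ) < 2)]
      rw [← Real.exp_nat_mul, ← Real.exp_add]
      congr 1
      ring

/-- No measurability of `A` is needed. -/
theorem one_le_measureReal_add_compl {Ω : Type*} [MeasurableSpace Ω] (μ : Measure Ω)
    [IsProbabilityMeasure μ] (A : Set Ω) : 1 ≤ μ.real A + μ.real Aᶜ := by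
  have h := measureReal_union_le (μ := μ) A Aᶜ
  rwa [Set.union_compl_self, probReal_univ] at h

theorem sub_inv_le_imbalance {n : ℕ} (hn : n ≠ 0) {α : ℝ} {y : Assignment n 2}
    (hy : (Finset.univ.filter fun v => y v = 0).card = ⌊α * n⌋₊) :
    α - 1 / 2 - (n : ℝ)⁻¹ ≤ imbalance y := by
  have hn0 : (0 : ℝ) < n := by positivity
  have h := (Nat.lt_floor_add_one (α * n)).le
  rw [imbalance, hy]
  have h2 : α - (n : ℝ)⁻¹ ≤ (⌊α * n⌋₊ : ℝ) / n := by
    rw [le_div_iff₀ hn0, sub_mul, inv_mul_cancel₀ hn0.ne']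
    linarith
  linarith

end GaussianMixture

theorem mainTheorem5
    (α : ℝ) (hα : 1 / 2 < α) (hα' : α < 2 / 3)
    (δ : ℝ) (hδ : 0 < δ)
    -- the true assignments, with communities of sizes `⌊αn⌋` and `n - ⌊αn⌋`
    (y : ∀ n : ℕ, GaussianMixture.Assignment n 2)
    (hy₀ : ∀ n : ℕ, (Finset.univ.filter fun v => y n v = 0).card = ⌊α * n⌋₊)
    (hy₁ : ∀ n : ℕ, (Finset.univ.filter fun v => y n v = 1).card = n - ⌊α * n⌋₊)
    -- the standard deviations, which may depend on `n`
    (s : ℕ → ℝ) (hs_pos : ∀ n : ℕ, 0 < s n)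
    (hs : ∀ᶠ n : ℕ in atTop,
      s n < (1 - δ) * (2 * α - 1) / Real.sqrt (8 * Real.log n))
    -- for each `n`, i.i.d. `N(0, s²)` variables attached to the vertices
    (Ω : ℕ → Type*) [∀ n, MeasurableSpace (Ω n)]
    (μ : ∀ n, Measure (Ω n)) [∀ n, IsProbabilityMeasure (μ n)]
    (ξ : ∀ n : ℕ, Fin n → Ω n → ℝ)
    (hξ_law : ∀ (n : ℕ) (v : Fin n), HasLaw (ξ n v) (gaussianReal 0 (s n ^ 2).toNNReal) (μ n))
    (hξ_indep : ∀ n : ℕ, iIndepFun (ξ n) (μ n)) :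
    Tendsto
      (fun n : ℕ => (μ n) {ω |
        GaussianMixture.mleSet (GaussianMixture.sameCommunity n 2)
            (GaussianMixture.covMatrix (μ n) (GaussianMixture.vertexNoise (ξ n)))
            (GaussianMixture.observation (y n) (ξ n) ω)
          ⊆ GaussianMixture.equivClass (GaussianMixture.sameCommunity n 2) (y n)})
      atTop (𝓝 1) := by
  set a := 2 * α - 1 with ha
  set κ := (1 - δ) * a with hκ
  have ha0 : 0 < a := by linarith
  have ha1 : a ≤ 1 := by linarith
  have hκa : κ < a := by rw [hκ]; nlinarith
  -- Positivity of the noise level rules out `δ ≥ 1`.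
  have hκ0 : 0 < κ := by
    obtain ⟨n, hn⟩ := hs.exists
    by_contra h
    exact (hs_pos n).not_ge (hn.le.trans
      (div_nonpos_of_nonpos_of_nonneg (not_lt.mp h) (Real.sqrt_nonneg _)))
  have hρ : 1 < ((a + κ) / 2) ^ 2 / κ ^ 2 := by
    rw [one_lt_div (by positivity)]
    exact pow_lt_pow_left₀ (by linarith) hκ0.le two_ne_zero
  have hc : 0 < (a - κ) / 6 * (a / 8) ^ 2 / κ ^ 2 := by
    have : 0 < a - κ := by linarith
    positivity
  have hinv : ∀ᶠ n : ℕ in atTop, (n : ℝ)⁻¹ ≤ (a - κ) / 12 :=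
    (tendsto_inv_atTop_nhds_zero_nat (𝕜 := ℝ)).eventually_le_const (by linarith)
  have hF := (tendsto_const_nhds (x := (1 : ℝ))).sub (GaussianMixture.tendsto_union_bound hρ hc)
  rw [sub_zero] at hF
  rw [← ENNReal.tendsto_toReal_iff (fun n => measure_ne_top _ _) ENNReal.one_ne_top,
    ENNReal.toReal_one]
  refine tendsto_of_tendsto_of_tendsto_of_le_of_le' hF tendsto_const_nhds ?_
    (Eventually.of_forall fun n => measureReal_le_one)
  filter_upwards [hs, hinv, eventually_gt_atTop 1] with n hsn hninv hn1
  have hn : n ≠ 0 := by omega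
  have hlog : 0 < Real.log n := Real.log_pos (by exact_mod_cast hn1)
  have hσκ : 8 * s n ^ 2 * Real.log n ≤ κ ^ 2 := by
    rw [lt_div_iff₀ (Real.sqrt_pos.mpr (by positivity))] at hsn
    have h := pow_le_pow_left₀ (mul_nonneg (hs_pos n).le (Real.sqrt_nonneg _)) hsn.le 2
    rw [mul_pow, Real.sq_sqrt (by positivity)] at h
    linarith
  have hy : a / 2 - (a - κ) / 12 ≤ GaussianMixture.imbalance (y n) := by
    have := GaussianMixture.sub_inv_le_imbalance hn (hy₀ n)
    linarith
  have hfail := GaussianMixture.measureReal_not_mleSet_subset_le hn (hs_pos n) (hξ_law n)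
    (hξ_indep n) (y n)
  have hbound := hfail.trans ((Finset.sum_le_sum fun z hz =>
    GaussianMixture.exp_neg_sum_sq_pulledSignal_sub_le hn hκ0 hκa ha1 (hs_pos n) hσκ
      (Finset.mem_filter.mp hz).2.2 hy).trans
    ((Finset.sum_le_sum_of_subset_of_nonneg
      (Finset.monotone_filter_right _ fun z _ h => h.1) fun z _ _ => by positivity).trans
    (GaussianMixture.sum_ne_pow_hammingDist_add_const (y n) _ _ (Real.exp_pos _).le)))
  have hcover := GaussianMixture.one_le_measureReal_add_compl (μ n) {ω |
        GaussianMixture.mleSet (GaussianMixture.sameCommunity n 2)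
            (GaussianMixture.covMatrix (μ n) (GaussianMixture.vertexNoise (ξ n)))
            (GaussianMixture.observation (y n) (ξ n) ω)
          ⊆ GaussianMixture.equivClass (GaussianMixture.sameCommunity n 2) (y n)}
  change _ ≤ (μ n).real _
  linarith
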